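/- There is an absolute constant $C>0$ with the following property. For integers $N_1,\dots,N_d\ge 0$, a $d$-dimensional progression with side lengths $N_1,\dots,N_d$ in an abelian group $G$ is a set of the form $P=\{a+l_1x_1+\dots+l_dx_d : l_i\in\mathbb{Z},\ 1\le l_i\le N_i \text{ for } 1\le i\le d\}$ with $a,x_1,\dots,x_d\in G$; it is proper if these sums are distinct for distinct tuples $(l_1,\dots,l_d)$. Let $\varepsilon\in(0,1/2)$ be real, let $d\ge 0$ be an integer, let $G$ be an abelian group, and let $P\subseteq G$ be a proper $d$-dimensional progression with side lengths $N_1,\dots,N_d>C/\varepsilon$. Let $\eta:P\to\mathbb{R}/\mathbb{Z}$ be a Freiman homomorphism (that is, $\eta(x_1)+\eta(x_2)=\eta(x_3)+\eta(x_4)$ whenever $x_1,x_2,x_3,x_4\in P$ satisfy $x_1+x_2=x_3+x_4$) which vanishes at some point of $P$. Then the set $\{x\in P:\|\eta(x)\|_{\mathbb{R}/\mathbb{Z}}\le\varepsilon\}$, where $\|\cdot\|_{\mathbb{R}/\mathbb{Z}}$ denotes the distance to the nearest integer, contains a progression of dimension at most $d+1$ and of cardinality at least $(Cd)^{-d}\varepsilon^{d+1}|P|$,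 where $(Cd)^{-d}$ is read as $1$ when $d=0$. -/

import Mathlib

/-- The data of a `d`-dimensional (generalised arithmetic) progression in an abelian group `G`:
an affine map `ℤ^d → G`, given by a base point and `d` steps, and the side lengths
`N_1, …, N_d` of a box `[N_1] × ⋯ × [N_d]`, where `[N] = {1, …, N}`. -/
structure Progression (G : Type*) [AddCommGroup G] (d : ℕ) where
  base : G
  step : Fin d → G
  side : Fin d → ℕ

namespace Progression

/-- The affine map `l ↦ a + l_1 x_1 + ⋯ + l_d x_d`. -/
def param {G : Type*} [AddCommGroup G] {d : ℕ} (P : Progression G d) (l : Fin d → ℤ) : G :=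
  P.base + ∑ i, l i • P.step i

/-- The box `[N_1] × ⋯ × [N_d]` in `ℤ^d`. -/
def box {G : Type*} [AddCommGroup G] {d : ℕ} (P : Progression G d) : Set (Fin d → ℤ) :=
  {l | ∀ i, 1 ≤ l i ∧ l i ≤ (P.side i : ℤ)}

/-- The progression as a set: the image of the box under the affine map. -/
def carrier {G : Type*} [AddCommGroup G] {d : ℕ} (P : Progression G d) : Set G :=
  P.param '' P.box

/-- A progression is proper if distinct points of the box have distinct images. -/
def IsProper {G : Type*} [AddCommGroup G] {d : ℕ} (P : Progression G d) : Prop :=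
  Set.InjOn P.param P.box

end Progression

/-! On the coordinates of `P`, `η` is affine: around a zero with coordinates `a` it is `l ↦ ∑ (l i -
a i) • θ i`. After reversing some axes, every axis has room in the positive direction from `a`. It
then suffices to find a progression in a Bohr set `|m i| ≤ M i`, `‖∑ m i α i‖ ≤ ε / 2` of `ℤ^d`,
with `M i` about `ε N i / 10`.

Adding the approximating integer as a coordinate turns this set into the points of `ℤ^{d+1}` that an
injective homomorphism sends to a cube. Pigeonholing fractional parts gives many such points.
Vectors attaining successive minima span a box inside the cube, and a count of residues bounds the
points by the size of that box (`exists_independent_box_in_ball`).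

The Bohr progression has coordinates of both signs, while `a` may lie at a corner. Dirichlet's
theorem gives `1 ≤ j ≤ ⌈2 / ε⌉` for which translation by `j M` changes `η` by at most `ε / 2` and
makes all displacements nonnegative. Fitting this translate in `P` forces the factor `ε` in each `M
i`; the Bohr radius costs one more. -/

/-! ### Geometry of numbers: successive minima -/

/-- Some unimodular change of coordinates moves a given integer vector to the first axis. -/
theorem exists_linearEquiv_apply_succ_eq_zero {n : ℕ} (w : Fin (n + 1) → ℤ) :
    ∃ e : (Fin (n + 1) → ℤ) ≃ₗ[ℤ] (Fin (n + 1) → ℤ), ∀ j : Fin n, e w j.succ = 0 := by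
  obtain ⟨b, i₀, hb⟩ : ∃ (b : Module.Basis (Fin (n + 1)) ℤ (Fin (n + 1) → ℤ)) (i₀ : Fin (n + 1)),
      ∀ i, i ≠ i₀ → b.repr w i = 0 := by
    -- The span of `w` has rank at most one, so its Smith basis puts `w` on a single axis.
    obtain ⟨r, s⟩ := Submodule.smithNormalForm (Pi.basisFun ℤ (Fin (n + 1))) (ℤ ∙ w)
    have hr : r ≤ 1 := by
      have h1 := Module.finrank_eq_card_basis s.bN
      have h2 : Module.finrank ℤ (ℤ ∙ w) ≤ 1 := by
        simpa using finrank_span_le_card (R := ℤ) ({w} : Set (Fin (n + 1) → ℤ))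
      simpa [h1] using h2
    have hw : w ∈ (ℤ ∙ w) := Submodule.mem_span_singleton_self w
    have key : ∀ i, i ∉ Set.range s.f → s.bM.repr w i = 0 := fun i hi =>
      s.repr_eq_zero_of_notMem_range ⟨w, hw⟩ hi
    rcases Nat.eq_zero_or_pos r with h0 | h0
    · subst h0
      exact ⟨s.bM, 0, fun i _ => key i (by simp)⟩
    · refine ⟨s.bM, s.f ⟨0, h0⟩, fun i hi => key i ?_⟩
      rintro ⟨j, rfl⟩
      exact hi (congrArg s.f (Fin.ext (by have := j.2; simp only; omega)))
  refine ⟨b.equivFun ≪≫ₗ LinearEquiv.funCongrLeft ℤ ℤ (Equiv.swap 0 i₀), fun j => ?_⟩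
  have : Equiv.swap 0 i₀ j.succ ≠ i₀ := by
    intro h
    have h' := congrArg (Equiv.swap 0 i₀) h
    simp at h'
  simpa [LinearEquiv.funCongrLeft_apply, LinearMap.funLeft_apply] using hb _ this

/-- Vectors realising the successive minima of a function on `ℤ^n`, together with coordinates
adapted to the flag that they span. -/
theorem exists_linearEquiv_successive_minima (n : ℕ) : ∀ N : (Fin n → ℤ) → ℝ,
    (∀ S : Set (Fin n → ℤ), S.Nonempty → ∃ x ∈ S, ∀ y ∈ S, N x ≤ N y) →
    ∃ (e : (Fin n → ℤ) ≃ₗ[ℤ] (Fin n → ℤ)) (v : Fin n → Fin n → ℤ), ∀ k,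
      e (v k) k ≠ 0 ∧ (∀ j, k < j → e (v k) j = 0) ∧
      ∀ x, (∃ j, k ≤ j ∧ e x j ≠ 0) → N (v k) ≤ N x := by
  induction n with
  | zero => exact fun N _ => ⟨LinearEquiv.refl ℤ _, fun _ => 0, fun k => k.elim0⟩
  | succ n ih =>
    intro N hN
    obtain ⟨w, hw, hmin⟩ := hN {x | x ≠ 0} ⟨fun _ => 1, fun h => by simpa using congrFun h 0⟩
    obtain ⟨e₀, he₀⟩ := exists_linearEquiv_apply_succ_eq_zero w
    -- Induct on the quotient by `w`, measuring each class by its smallest representative.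
    have hlift : ∀ y : Fin n → ℤ, ∃ x, Fin.tail (e₀ x) = y ∧
        ∀ z, Fin.tail (e₀ z) = y → N x ≤ N z := fun y =>
      hN {x | Fin.tail (e₀ x) = y} ⟨e₀.symm (Fin.cons 0 y), by simp⟩
    choose lift lift_tail lift_le using hlift
    obtain ⟨e', v', h'⟩ := ih (fun y => N (lift y)) (by
      rintro S ⟨y, hy⟩
      obtain ⟨x, hx, hxmin⟩ := hN {x | Fin.tail (e₀ x) ∈ S} ⟨lift y, by simpa [lift_tail] using hy⟩
      exact ⟨_, hx, fun z hz => (lift_le _ x rfl).trans (hxmin _ (by simpa [lift_tail] using hz))⟩)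
    let c := Fin.consLinearEquiv ℤ (fun _ : Fin (n + 1) => ℤ)
    let e : (Fin (n + 1) → ℤ) ≃ₗ[ℤ] (Fin (n + 1) → ℤ) :=
      e₀ ≪≫ₗ c.symm ≪≫ₗ ((LinearEquiv.refl ℤ ℤ).prodCongr e') ≪≫ₗ c
    have e_zero : ∀ x, e x 0 = e₀ x 0 := fun x => rfl
    have e_succ : ∀ x j, e x (Fin.succ j) = e' (Fin.tail (e₀ x)) j := fun x j => rfl
    have w_tail : Fin.tail (e₀ w) = 0 := funext he₀
    refine ⟨e, Fin.cons w (fun k => lift (v' k)), fun k => ?_⟩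
    refine Fin.cases ⟨?_, ?_, ?_⟩ (fun k => ⟨?_, ?_, ?_⟩) k
    · simp only [Fin.cons_zero, e_zero]
      intro h0
      refine hw (e₀.injective ?_)
      rw [map_zero]
      exact funext fun j => Fin.cases h0 he₀ j
    · intro j hj
      obtain ⟨j, rfl⟩ := Fin.exists_succ_eq.2 hj.ne'
      simp [e_succ, w_tail]
    · rintro x ⟨j, -, hj⟩
      refine hmin x ?_
      rintro rfl
      simp at hj
    · simpa [e_succ, lift_tail] using (h' k).1
    · intro j hj
      obtain ⟨j, rfl⟩ := Fin.exists_succ_eq.2 (Fin.ne_zero_of_lt hj)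
      simpa [e_succ, lift_tail] using (h' k).2.1 j (by simpa using hj)
    · rintro x ⟨j, hkj, hj⟩
      obtain ⟨j, rfl⟩ := Fin.exists_succ_eq.2 (Fin.ne_zero_of_lt
        (lt_of_lt_of_le (Fin.succ_pos k) hkj))
      rw [e_succ] at hj
      simp only [Fin.cons_succ]
      exact ((h' k).2.2 _ ⟨j, by simpa using hkj, hj⟩).trans (lift_le _ x rfl)

/-- Rounding up to powers of two turns ordered moduli into a divisibility chain, at the cost of a
factor two. -/
theorem exists_monotone_lt_two_pow : ∃ a : ℝ → ℕ, Monotone a ∧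
    ∀ r, r < 2 ^ a r ∧ (2 : ℝ) ^ a r ≤ max 1 (2 * r) := by
  classical
  have h (r : ℝ) : ∃ k : ℕ, r < 2 ^ k := pow_unbounded_of_one_lt r one_lt_two
  refine ⟨fun r => Nat.find (h r),
    fun r s hrs => Nat.find_min' _ (hrs.trans_lt (Nat.find_spec (h s))),
    fun r => ⟨Nat.find_spec (h r), ?_⟩⟩
  rcases hk : Nat.find (h r) with _ | k
  · simp [hk]
  · refine le_max_of_le_right ?_
    have := Nat.find_min (h r) (m := k) (by omega)
    simp only [hk, pow_succ]
    linarith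

/-- A finite set of lattice points in a symmetric convex body has at most `(4n)^n` times as many
elements as a suitable `n`-dimensional progression of lattice points in the same body. -/
theorem exists_independent_box_in_ball {n : ℕ} (hn : 0 < n) {E : Type*} [NormedAddCommGroup E]
    [NormedSpace ℝ E] (A : (Fin n → ℤ) →+ E) (hA : Function.Injective A)
    (hfin : ∀ r : ℝ, {x | ‖A x‖ ≤ r}.Finite) (T : Finset (Fin n → ℤ)) (hT : ∀ x ∈ T, ‖A x‖ ≤ 1) :
    ∃ (v : Fin n → Fin n → ℤ) (L : Fin n → ℕ),
      (∀ t : Fin n → ℤ, (∀ k, 0 ≤ t k ∧ t k ≤ L k) → ‖A (∑ k, t k • v k)‖ ≤ 1) ∧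
      Function.Injective (fun t : Fin n → ℤ => ∑ k, t k • v k) ∧
      (T.card : ℝ) ≤ (4 * n) ^ n * ∏ k, ((L k : ℝ) + 1) := by
  classical
  have hsmul (z : ℤ) (x : Fin n → ℤ) : ‖A (z • x)‖ = |(z : ℝ)| * ‖A x‖ := by
    rw [map_zsmul, norm_zsmul ℝ, Real.norm_eq_abs]
  obtain ⟨e, v, hv⟩ := exists_linearEquiv_successive_minima n (fun x => ‖A x‖) (by
    rintro S ⟨x, hx⟩
    obtain ⟨y, hy, hmin⟩ := ((hfin ‖A x‖).inter_of_right S).exists_minimalFor (fun x => ‖A x‖) _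
      ⟨x, hx, le_refl ‖A x‖⟩
    refine ⟨y, hy.1, fun z hz => ?_⟩
    rcases le_total ‖A y‖ ‖A z‖ with h | h
    · exact h
    · exact hmin ⟨hz, h.trans hy.2⟩ h)
  have hne (k) : v k ≠ 0 := fun h => (hv k).1 (by simp [h])
  have hpos (k) : 0 < ‖A (v k)‖ := norm_pos_iff.2 fun h => hne k (hA (by simpa using h))
  have hn' : (0 : ℝ) < n := by exact_mod_cast hn
  have hmono {k j} (h : k ≤ j) : ‖A (v k)‖ ≤ ‖A (v j)‖ := (hv k).2.2 _ ⟨j, h, (hv j).1⟩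
  -- Each of the `n` terms then has norm at most `1 / n`.
  refine ⟨v, fun k => ⌊1 / (n * ‖A (v k)‖)⌋₊, fun t ht => ?_, fun t s hts => ?_, ?_⟩
  · rw [map_sum]
    calc ‖∑ k, A (t k • v k)‖ ≤ ∑ k, ‖A (t k • v k)‖ := norm_sum_le _ _
      _ ≤ ∑ _k : Fin n, 1 / (n : ℝ) := by
        refine Finset.sum_le_sum fun k _ => ?_
        rw [hsmul, abs_of_nonneg (by exact_mod_cast (ht k).1)]
        have h1 : (t k : ℝ) ≤ ⌊1 / (n * ‖A (v k)‖)⌋₊ := by exact_mod_cast (ht k).2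
        have h2 : (t k : ℝ) ≤ 1 / (n * ‖A (v k)‖) :=
          h1.trans (Nat.floor_le (by have := hpos k; positivity))
        calc (t k : ℝ) * ‖A (v k)‖ ≤ 1 / (n * ‖A (v k)‖) * ‖A (v k)‖ :=
              mul_le_mul_of_nonneg_right h2 (hpos k).le
          _ = 1 / n := by have := (hpos k).ne'; field_simp
      _ = 1 := by simp [hn'.ne']
  · by_contra hne'
    have hd : (Finset.univ.filter fun k => t k - s k ≠ 0).Nonempty := by
      obtain ⟨k, hk⟩ := Function.ne_iff.1 hne'
      exact ⟨k, by simpa [sub_eq_zero] using hk⟩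
    obtain ⟨k, hk, hmax⟩ := Finset.exists_maximal hd
    have hz : ∑ j, (t j - s j) • v j = 0 := by
      simpa [sub_smul, sub_eq_zero] using hts
    have h0 : e (∑ j, (t j - s j) • v j) k = 0 := by rw [hz, map_zero, Pi.zero_apply]
    rw [map_sum, Finset.sum_apply, Finset.sum_eq_single k] at h0
    · rw [map_smul, Pi.smul_apply, smul_eq_mul, mul_eq_zero] at h0
      exact h0.elim (Finset.mem_filter.1 hk).2 (hv k).1
    · intro j _ hjk
      rw [map_smul, Pi.smul_apply, smul_eq_mul]
      rcases lt_or_gt_of_ne hjk with h | h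
      · rw [(hv j).2.1 k h, mul_zero]
      · by_cases hj : t j - s j = 0
        · rw [hj, zero_mul]
        · exact absurd (hmax (Finset.mem_filter.2 ⟨Finset.mem_univ j, hj⟩) h.le) (not_le.2 h)
    · simp
  · obtain ⟨a, ha, hpow⟩ := exists_monotone_lt_two_pow
    set q : Fin n → ℕ := fun k => 2 ^ a (2 / ‖A (v k)‖) with hq
    have hqpos (k) : 0 < q k := by positivity
    have hdvd {j k} (h : j ≤ k) : q k ∣ q j :=
      pow_dvd_pow 2 (ha (by have := hpos j; have := hmono h; gcongr))
    have hcard : T.card ≤ (Fintype.piFinset fun k => Finset.Ico (0 : ℤ) (q k)).card := by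
      -- If `x ≠ y` share all residues, let `k` be the last coordinate where they differ. The
      -- divisibility chain gives `x - y = q k • z` with `z` nonzero at `k`, so minimality of `v k`
      -- makes `‖A (x - y)‖ ≥ q k * ‖A (v k)‖ > 2`, which is absurd.
      refine Finset.card_le_card_of_injOn (fun x k => e x k % q k) ?_ ?_
      · intro x _
        simp only [Finset.mem_coe, Fintype.mem_piFinset, Finset.mem_Ico]
        exact fun k => ⟨Int.emod_nonneg _ (by exact_mod_cast (hqpos k).ne'),
          Int.emod_lt_of_pos _ (by exact_mod_cast hqpos k)⟩
      · intro x hx y hy hxy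
        by_contra hne'
        have hd : (Finset.univ.filter fun k => e (x - y) k ≠ 0).Nonempty := by
          obtain ⟨k, hk⟩ := Function.ne_iff.1 (show e (x - y) ≠ 0 by simpa [sub_eq_zero] using hne')
          exact ⟨k, by simpa using hk⟩
        obtain ⟨k, hk, hmax⟩ := Finset.exists_maximal hd
        have hdiv (j) : (q k : ℤ) ∣ e (x - y) j := by
          rcases le_or_gt j k with h | h
          · refine (Int.natCast_dvd_natCast.2 (hdvd h)).trans ?_
            rw [map_sub, Pi.sub_apply]
            exact Int.ModEq.dvd (congrFun hxy j).symm
          · by_cases hj : e (x - y) j = 0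
            · simp [hj]
            · exact absurd (hmax (Finset.mem_filter.2 ⟨Finset.mem_univ j, hj⟩) h.le) (not_le.2 h)
        choose c hc using hdiv
        have hxyc : x - y = (q k : ℤ) • e.symm c := by
          apply e.injective
          ext j
          rw [map_smul, Pi.smul_apply, LinearEquiv.apply_symm_apply, smul_eq_mul, hc j]
        have hck : c k ≠ 0 := by
          intro h
          exact (Finset.mem_filter.1 hk).2 (by rw [hc, h, mul_zero])
        have h1 := (hv k).2.2 (e.symm c) ⟨k, le_rfl, by simpa using hck⟩
        have h2 : ‖A (x - y)‖ ≤ 2 := by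
          rw [map_sub]
          have := norm_sub_le (A x) (A y)
          linarith [hT x hx, hT y hy]
        rw [hxyc, hsmul, abs_of_nonneg (by positivity)] at h2
        have h3 : 2 / ‖A (v k)‖ < (q k : ℝ) := by simpa [hq] using (hpow (2 / ‖A (v k)‖)).1
        rw [div_lt_iff₀ (hpos k)] at h3
        have h4 : ((q k : ℤ) : ℝ) = (q k : ℝ) := by simp
        rw [h4] at h2
        have h5 := mul_le_mul_of_nonneg_left h1 (Nat.cast_nonneg (α := ℝ) (q k))
        linarith
    have hprod : ((Fintype.piFinset fun k => Finset.Ico (0 : ℤ) (q k)).card : ℝ)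
        = ∏ k, (q k : ℝ) := by simp [Fintype.card_piFinset]
    calc (T.card : ℝ) ≤ ∏ k, (q k : ℝ) := by rw [← hprod]; exact_mod_cast hcard
      _ ≤ ∏ k, (4 * n * ((⌊1 / (n * ‖A (v k)‖)⌋₊ : ℝ) + 1)) := by
        refine Finset.prod_le_prod (fun k _ => by positivity) fun k _ => ?_
        have h1 := (hpow (2 / ‖A (v k)‖)).2
        have h2 : 1 / (n * ‖A (v k)‖) < (⌊1 / (n * ‖A (v k)‖)⌋₊ : ℝ) + 1 := Nat.lt_floor_add_one _
        simp only [hq, Nat.cast_pow, Nat.cast_ofNat]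
        refine h1.trans (max_le ?_ ?_)
        · have h3 : (1 : ℝ) ≤ n := by exact_mod_cast hn
          have h4 : (0 : ℝ) ≤ ⌊1 / (n * ‖A (v k)‖)⌋₊ := Nat.cast_nonneg _
          nlinarith
        · have h3 : 2 * (2 / ‖A (v k)‖) = 4 * n * (1 / (n * ‖A (v k)‖)) := by
            have := (hpos k).ne'
            field_simp
            norm_num
          rw [h3]
          gcongr
      _ = (4 * n) ^ n * ∏ k, ((⌊1 / (n * ‖A (v k)‖)⌋₊ : ℝ) + 1) := by
        rw [Finset.prod_mul_distrib]; simp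

/-! ### Bohr sets as lattice points in a cube -/

/-- The homomorphism `ℤ^{d+1} → ℝ^{d+1}` for which the preimage of the unit cube parametrises a Bohr
set with frequencies `θ`, side lengths `M` and radius `δ`. The first coordinate of an integer vector
is the integer approximating the value of the linear form `θ`. -/
noncomputable def bohrMap {d : ℕ} (θ : Fin d → ℝ) (M : Fin d → ℕ) (δ : ℝ) :
    (Fin (d + 1) → ℤ) →+ (Fin (d + 1) → ℝ) :=
  AddMonoidHom.mk' (fun x => Fin.cons ((∑ i, (x i.succ : ℝ) * θ i - x 0) / δ)
    (fun i => (x i.succ : ℝ) / M i)) (by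
    intro x y
    ext j
    refine Fin.cases ?_ (fun i => ?_) j
    · simp only [Fin.cons_zero, Pi.add_apply, Int.cast_add, add_mul, Finset.sum_add_distrib]
      ring
    · simp only [Fin.cons_succ, Pi.add_apply, Int.cast_add]
      ring)

theorem norm_bohrMap_le_iff {d : ℕ} (θ : Fin d → ℝ) {M : Fin d → ℕ} (hM : ∀ i, 0 < M i) {δ : ℝ}
    (hδ : 0 < δ) {r : ℝ} (hr : 0 ≤ r) (x : Fin (d + 1) → ℤ) :
    ‖bohrMap θ M δ x‖ ≤ r ↔ |∑ i, (x i.succ : ℝ) * θ i - x 0| ≤ r * δ ∧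
      ∀ i : Fin d, |(x i.succ : ℝ)| ≤ r * M i := by
  rw [pi_norm_le_iff_of_nonneg hr, Fin.forall_fin_succ]
  refine and_congr ?_ (forall_congr' fun i => ?_)
  · simp only [bohrMap, AddMonoidHom.mk'_apply, Fin.cons_zero, Real.norm_eq_abs, abs_div,
      abs_of_pos hδ]
    rw [div_le_iff₀ hδ]
  · have : (0 : ℝ) < M i := by exact_mod_cast hM i
    simp only [bohrMap, AddMonoidHom.mk'_apply, Fin.cons_succ, Real.norm_eq_abs, abs_div,
      abs_of_pos this]
    rw [div_le_iff₀ this]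

theorem bohrMap_injective {d : ℕ} (θ : Fin d → ℝ) {M : Fin d → ℕ} (hM : ∀ i, 0 < M i) {δ : ℝ}
    (hδ : 0 < δ) : Function.Injective (bohrMap θ M δ) := by
  rw [injective_iff_map_eq_zero]
  intro x hx
  have h := (norm_bohrMap_le_iff θ hM hδ le_rfl x).1 (by simp [hx])
  have h1 (i : Fin d) : x i.succ = 0 := by simpa using h.2 i
  have h0 : x 0 = 0 := by simpa [h1] using h.1
  exact funext fun j => Fin.cases h0 h1 j

theorem finite_norm_bohrMap_le {d : ℕ} (θ : Fin d → ℝ) {M : Fin d → ℕ} (hM : ∀ i, 0 < M i) {δ : ℝ}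
    (hδ : 0 < δ) (r : ℝ) : {x | ‖bohrMap θ M δ x‖ ≤ r}.Finite := by
  rcases lt_or_ge r 0 with hr | hr
  · convert Set.finite_empty
    ext x
    simpa using hr.trans_le (norm_nonneg _)
  set R : Fin (d + 1) → ℝ := Fin.cons (r * δ + ∑ i, r * M i * |θ i|) (fun i => r * M i) with hR
  refine (Set.Finite.pi' (t := fun j => Set.Icc (-⌈R j⌉) ⌈R j⌉) fun j => Set.finite_Icc _ _).subset ?_
  intro x hx
  obtain ⟨h0, h1⟩ := (norm_bohrMap_le_iff θ hM hδ hr x).1 hx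
  have hb : ∀ j, |(x j : ℝ)| ≤ R j := by
    refine fun j => Fin.cases ?_ h1 j
    simp only [hR, Fin.cons_zero]
    have h2 : |∑ i, (x i.succ : ℝ) * θ i| ≤ ∑ i, r * M i * |θ i| :=
      (Finset.abs_sum_le_sum_abs _ _).trans (Finset.sum_le_sum fun i _ => by
        rw [abs_mul]; exact mul_le_mul_of_nonneg_right (h1 i) (abs_nonneg _))
    rw [abs_le] at h0 h2 ⊢
    constructor <;> linarith [h0.1, h0.2, h2.1, h2.2]
  intro j
  have h3 := (hb j).trans (Int.le_ceil _)
  rw [← Int.cast_abs, Int.cast_le, abs_le] at h3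
  exact h3

/-- A lower bound for the number of lattice points parametrising a Bohr set. -/
theorem exists_card_bohrMap_le_one {d : ℕ} (θ : Fin d → ℝ) {M : Fin d → ℕ} (hM : ∀ i, 0 < M i)
    {δ : ℝ} (hδ : 0 < δ) (hδ1 : δ ≤ 1) :
    ∃ T : Finset (Fin (d + 1) → ℤ), (∀ x ∈ T, ‖bohrMap θ M δ x‖ ≤ 1) ∧
      δ / 2 * ∏ i, ((M i : ℝ) + 1) ≤ T.card := by
  classical
  set s : Finset (Fin d → ℤ) := Fintype.piFinset fun i => Finset.Icc (0 : ℤ) (M i)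
  have hs : (s.card : ℝ) = ∏ i, ((M i : ℝ) + 1) := by
    simp only [s, Fintype.card_piFinset, Int.card_Icc, Nat.cast_prod]
    refine Finset.prod_congr rfl fun i _ => ?_
    have : ((M i : ℤ) + 1 - 0).toNat = M i + 1 := by omega
    rw [this]
    push_cast
    rfl
  set φ : (Fin d → ℤ) → ℝ := fun m => ∑ i, (m i : ℝ) * θ i with hφ
  set f : (Fin d → ℤ) → ℕ := fun m => ⌊Int.fract (φ m) / δ⌋₊ with hf
  have hprod : 0 < ∏ i, ((M i : ℝ) + 1) := Finset.prod_pos fun i _ => by positivity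
  -- Pigeonhole on cells of length `δ` for the fractional part; there are at most `1 / δ + 1 ≤ 2 /
  -- δ` of them.
  obtain ⟨y, -, hy⟩ := Finset.exists_le_card_fiber_of_nsmul_le_card_of_maps_to (s := s)
    (t := Finset.range (⌊1 / δ⌋₊ + 1)) (f := f) (b := δ / 2 * ∏ i, ((M i : ℝ) + 1))
    (by
      intro m _
      rw [Finset.mem_range, Nat.lt_succ_iff]
      refine Nat.floor_mono ?_
      gcongr
      exact (Int.fract_lt_one _).le)
    (by simp)
    (by
      rw [hs, Finset.card_range, nsmul_eq_mul, ← mul_assoc]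
      refine mul_le_of_le_one_left hprod.le ?_
      have h1 : (⌊1 / δ⌋₊ : ℝ) ≤ 1 / δ := Nat.floor_le (by positivity)
      have h2 : (⌊1 / δ⌋₊ : ℝ) * δ ≤ 1 := by rwa [← le_div_iff₀ hδ]
      push_cast
      nlinarith)
  set F := s.filter fun m => f m = y with hF
  have hFne : F.Nonempty := by
    rw [← Finset.card_pos]
    have : (0 : ℝ) < F.card := lt_of_lt_of_le (by positivity) hy
    exact_mod_cast this
  obtain ⟨m₀, hm₀⟩ := hFne
  refine ⟨F.image fun m => Fin.cons (⌊φ m⌋ - ⌊φ m₀⌋) (m - m₀), ?_, ?_⟩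
  · simp only [Finset.mem_image]
    rintro _ ⟨m, hm, rfl⟩
    rw [norm_bohrMap_le_iff θ hM hδ zero_le_one]
    simp only [hF, Finset.mem_filter, s, Fintype.mem_piFinset, Finset.mem_Icc] at hm hm₀
    simp only [Fin.cons_succ, Fin.cons_zero, Pi.sub_apply, one_mul]
    constructor
    · have h1 : ∑ i, ((m i - m₀ i : ℤ) : ℝ) * θ i - ((⌊φ m⌋ - ⌊φ m₀⌋ : ℤ) : ℝ)
          = Int.fract (φ m) - Int.fract (φ m₀) := by
        simp only [Int.cast_sub, sub_mul, Finset.sum_sub_distrib, Int.fract, hφ]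
        ring
      have bound (m) (hm : f m = y) : y * δ ≤ Int.fract (φ m) ∧ Int.fract (φ m) < (y + 1) * δ := by
        rw [← le_div_iff₀ hδ, ← div_lt_iff₀ hδ, ← hm]
        exact ⟨Nat.floor_le (div_nonneg (Int.fract_nonneg _) hδ.le), Nat.lt_floor_add_one _⟩
      have h2 := bound m hm.2
      have h3 := bound m₀ hm₀.2
      rw [h1, abs_le]
      constructor <;> linarith [h2.1, h2.2, h3.1, h3.2]
    · intro i
      have h1 := hm.1 i
      have h2 := hm₀.1 i
      have : |m i - m₀ i| ≤ (M i : ℤ) := by rw [abs_le]; constructor <;> linarith [h1.1, h1.2, h2.1, h2.2]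
      exact_mod_cast this
  · rw [Finset.card_image_of_injective]
    · exact hy
    · intro m m' h
      simpa using (Fin.cons_inj.1 h).2

/-- A Bohr set in a box in `ℤ^d` contains a large proper progression of dimension `d + 1`. -/
theorem exists_progression_in_bohr {d : ℕ} (θ : Fin d → ℝ) (M : Fin d → ℕ) (hM : ∀ i, 0 < M i)
    {δ : ℝ} (hδ : 0 < δ) (hδ4 : δ < 1 / 2) :
    ∃ (w : Fin (d + 1) → Fin d → ℤ) (L : Fin (d + 1) → ℕ),
      (∀ t : Fin (d + 1) → ℤ, (∀ k, 0 ≤ t k ∧ t k ≤ L k) →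
        (∀ i, |(∑ k, t k • w k) i| ≤ M i) ∧
        ‖((∑ i, ((∑ k, t k • w k) i : ℝ) * θ i : ℝ) : UnitAddCircle)‖ ≤ δ) ∧
      Set.InjOn (fun t : Fin (d + 1) → ℤ => ∑ k, t k • w k) {t | ∀ k, 0 ≤ t k ∧ t k ≤ L k} ∧
      δ / 2 * ∏ i, ((M i : ℝ) + 1) ≤ (4 * (d + 1)) ^ (d + 1) * ∏ k, ((L k : ℝ) + 1) := by
  obtain ⟨T, hT, hcard⟩ := exists_card_bohrMap_le_one θ hM hδ (by linarith)
  obtain ⟨v, L, hball, hinj, hL⟩ := exists_independent_box_in_ball d.succ_pos (bohrMap θ M δ)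
    (bohrMap_injective θ hM hδ) (finite_norm_bohrMap_le θ hM hδ) T hT
  have hcoord (t : Fin (d + 1) → ℤ) (i : Fin d) :
      (∑ k, t k • fun i => v k (Fin.succ i)) i = (∑ k, t k • v k) i.succ := by
    simp [Finset.sum_apply]
  refine ⟨fun k i => v k i.succ, L, fun t ht => ?_, fun t ht s hs hts => ?_, ?_⟩
  · obtain ⟨h0, h1⟩ := (norm_bohrMap_le_iff θ hM hδ zero_le_one _).1 (hball t ht)
    simp only [hcoord]
    refine ⟨fun i => by have := h1 i; rw [one_mul] at this; exact_mod_cast this, ?_⟩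
    rw [UnitAddCircle.norm_eq]
    exact (round_le _ ((∑ k, t k • v k) 0)).trans (by rwa [one_mul] at h0)
  -- Forgetting the first coordinate loses nothing: it lies within `δ` of the linear form, and two
  -- such integers differ by at most `2 * δ < 1`.
  · apply hinj
    have h1 (i : Fin d) : (∑ k, t k • v k) i.succ = (∑ k, s k • v k) i.succ := by
      rw [← hcoord, ← hcoord]
      exact congrFun hts i
    have ht' := ((norm_bohrMap_le_iff θ hM hδ zero_le_one _).1 (hball t ht)).1
    have hs' := ((norm_bohrMap_le_iff θ hM hδ zero_le_one _).1 (hball s hs)).1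
    refine funext fun j => Fin.cases ?_ h1 j
    simp only [h1] at ht'
    have h2 : |((∑ k, t k • v k) 0 : ℝ) - ((∑ k, s k • v k) 0 : ℝ)| < 1 := by
      rw [abs_le] at ht' hs'
      rw [abs_lt]
      constructor <;> linarith [ht'.1, ht'.2, hs'.1, hs'.2]
    have h3 : |(∑ k, t k • v k) 0 - (∑ k, s k • v k) 0| < 1 := by exact_mod_cast h2
    exact sub_eq_zero.1 (Int.abs_lt_one_iff.1 h3)
  · refine hcard.trans (hL.trans (le_of_eq ?_))
    push_cast
    rfl

/-! ### Freiman homomorphisms in coordinates -/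

namespace Progression

variable {G : Type*} [AddCommGroup G] {d : ℕ} (P : Progression G d)

theorem box_eq_piFinset :
    P.box = (Fintype.piFinset fun i => Finset.Icc (1 : ℤ) (P.side i) : Set (Fin d → ℤ)) := by
  ext l
  simp only [box, Set.mem_ofPred_eq, Finset.mem_coe, Fintype.mem_piFinset, Finset.mem_Icc]

theorem ncard_box : P.box.ncard = ∏ i, P.side i := by
  rw [box_eq_piFinset, Set.ncard_coe_finset, Fintype.card_piFinset]
  simp

theorem IsProper.ncard_carrier {P : Progression G d} (hP : P.IsProper) :
    P.carrier.ncard = ∏ i, P.side i := by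
  rw [carrier, Set.InjOn.ncard_image hP, ncard_box]

theorem param_add_param (l l' : Fin d → ℤ) : P.param l + P.param l' =
    2 • P.base + ∑ i, (l + l') i • P.step i := by
  simp only [param, Pi.add_apply, add_smul, Finset.sum_add_distrib]
  abel

/-- A Freiman homomorphism on a progression is an affine function of the coordinates. -/
theorem exists_freiman_eq_sum {H : Type*} [AddCommGroup H] (hside : ∀ i, 2 ≤ P.side i) {η : G → H}
    (hη : IsAddFreimanHom 2 P.carrier Set.univ η) :
    ∃ θ : Fin d → H, ∀ l ∈ P.box, η (P.param l) = η (P.param 1) + ∑ i, (l i - 1) • θ i := by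
  have hadd {a b c e : Fin d → ℤ} (ha : a ∈ P.box) (hb : b ∈ P.box) (hc : c ∈ P.box)
      (he : e ∈ P.box) (h : a + b = c + e) :
      η (P.param a) + η (P.param b) = η (P.param c) + η (P.param e) :=
    hη.add_eq_add ⟨a, ha, rfl⟩ ⟨b, hb, rfl⟩ ⟨c, hc, rfl⟩ ⟨e, he, rfl⟩
      (by rw [param_add_param, param_add_param, h])
  have h1 : (1 : Fin d → ℤ) ∈ P.box := fun i => by
    have := hside i
    simp only [Pi.one_apply]
    omega
  have h2 (i) : (1 + Pi.single i 1 : Fin d → ℤ) ∈ P.box := fun j => by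
    have := hside j
    rcases eq_or_ne j i with rfl | h
    · simp only [Pi.add_apply, Pi.one_apply, Pi.single_eq_same]
      omega
    · simp only [Pi.add_apply, Pi.one_apply, Pi.single_eq_of_ne h]
      omega
  refine ⟨fun i => η (P.param (1 + Pi.single i 1)) - η (P.param 1), ?_⟩
  suffices H : ∀ n : ℕ, ∀ l ∈ P.box, ∑ i, (l i - 1) = n → η (P.param l) =
      η (P.param 1) + ∑ i, (l i - 1) • (η (P.param (1 + Pi.single i 1)) - η (P.param 1)) by
    intro l hl
    have h0 : 0 ≤ ∑ i, (l i - 1) := Finset.sum_nonneg fun i _ => by have := (hl i).1; omega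
    exact H _ l hl (Int.toNat_of_nonneg h0).symm
  intro n
  induction n with
  | zero =>
    intro l hl hn
    have h3 := (Finset.sum_eq_zero_iff_of_nonneg fun i _ => by have := (hl i).1; omega).1 hn
    have h4 : l = 1 := funext fun i => by
      have := h3 i (Finset.mem_univ i)
      simp only [Pi.one_apply]
      omega
    simp [h4]
  | succ n ih =>
    intro l hl hn
    obtain ⟨i, hi⟩ : ∃ i, 1 < l i := by
      by_contra! h
      have := Finset.sum_nonpos (s := Finset.univ) fun i _ => sub_nonpos.2 (h i)
      omega
    have hl' : l - Pi.single i 1 ∈ P.box := fun j => by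
      have := hl j
      rcases eq_or_ne j i with rfl | h
      · simp only [Pi.sub_apply, Pi.single_eq_same]
        omega
      · simpa [Pi.single_eq_of_ne h] using this
    have h3 := ih _ hl' (by
      simp only [Pi.sub_apply, Finset.sum_sub_distrib, Finset.sum_pi_single'] at hn ⊢
      simp at hn ⊢
      omega)
    -- The additive quadruple `l + 1 = (l - e_i) + (1 + e_i)` lowers the coordinate sum by one.
    have h4 := hadd hl h1 hl' (h2 i) (by abel)
    have h5 : ∑ j, ((l - Pi.single i 1 : Fin d → ℤ) j - 1) •
          (η (P.param (1 + Pi.single j 1)) - η (P.param 1))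
        = ∑ j, (l j - 1) • (η (P.param (1 + Pi.single j 1)) - η (P.param 1)) -
          (η (P.param (1 + Pi.single i 1)) - η (P.param 1)) := by
      rw [eq_sub_iff_add_eq, eq_comm, ← sub_eq_iff_eq_add', ← Finset.sum_sub_distrib]
      rw [Finset.sum_eq_single i]
      · simp [← sub_smul]
      · intro j _ hj
        simp [Pi.single_eq_of_ne hj]
      · simp
    rw [eq_sub_of_add_eq h4, h3, h5]
    abel

end Progression

/-! ### Fitting the Bohr progression into `P` -/

/-- Collects the losses: `4` from the radius `ε / 2` and the pigeonhole, `10` per side from `M i`,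
the rest from the lattice count. Here `5120 = 32 * 2 * 10 * 8`. -/
theorem pow_mul_pow_le_mul_pow {d : ℕ} (hd : 0 < d) :
    (4 : ℝ) * 10 ^ d * (4 * (d + 1)) ^ (d + 1) ≤ (5120 * d) ^ d := by
  have h1 : (1 : ℝ) ≤ d := by exact_mod_cast hd
  have h2 : (d : ℝ) ≤ 2 ^ d := by exact_mod_cast Nat.lt_two_pow_self.le
  have h3 : (32 : ℝ) ≤ 32 ^ d := le_self_pow₀ (by norm_num) hd.ne'
  calc (4 : ℝ) * 10 ^ d * (4 * (d + 1)) ^ (d + 1) ≤ 4 * 10 ^ d * (8 * d) ^ (d + 1) := by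
        refine mul_le_mul_of_nonneg_left (pow_le_pow_left₀ (by positivity) ?_ _) (by positivity)
        linarith
    _ = 32 * d * (10 ^ d * (8 * d) ^ d) := by ring
    _ ≤ 32 ^ d * 2 ^ d * (10 ^ d * (8 * d) ^ d) := by gcongr
    _ = (5120 * d) ^ d := by
      rw [← mul_pow, ← mul_pow, ← mul_pow]
      congr 1
      ring

/-- Walking from `a` towards the farther end of the interval leaves about half its length. -/
theorem exists_sign_of_mem_Icc {N a : ℤ} (h1 : 1 ≤ a) (h2 : a ≤ N) :
    ∃ s : ℤ, s ≠ 0 ∧ ∀ u, 0 ≤ u → 2 * u ≤ N - 2 → 1 ≤ a + s * u ∧ a + s * u ≤ N := by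
  rcases le_or_gt (2 * a) N with h | h
  · exact ⟨1, one_ne_zero, fun u _ _ => by omega⟩
  · exact ⟨-1, by norm_num, fun u _ _ => by omega⟩

theorem Progression.exists_progression_subset_bohr {G : Type*} [AddCommGroup G] {d : ℕ}
    (hd : 0 < d) (P : Progression G d) {ε : ℝ} {η : G → UnitAddCircle} (hε : 0 < ε)
    (hε2 : ε < 1 / 2) (hP : P.IsProper) (hside : ∀ i, 5120 / ε < (P.side i : ℝ))
    (hη : IsAddFreimanHom 2 P.carrier Set.univ η) (hzero : ∃ x ∈ P.carrier, η x = 0) :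
    ∃ Q : Progression G (d + 1), Q.carrier ⊆ {x ∈ P.carrier | ‖η x‖ ≤ ε} ∧
      ((5120 * (d : ℝ)) ^ d)⁻¹ * ε ^ (d + 1) * (P.carrier.ncard : ℝ) ≤ (Q.carrier.ncard : ℝ) := by
  obtain ⟨_, ⟨a, ha, rfl⟩, hηa⟩ := hzero
  have hεN (i) : 5120 < ε * P.side i := by
    have := hside i
    rwa [div_lt_iff₀' hε] at this
  have hN (i) : (5120 : ℝ) < P.side i := by
    have := hεN i
    have h0 : (0 : ℝ) ≤ P.side i := Nat.cast_nonneg _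
    nlinarith
  obtain ⟨θ, hθ⟩ := P.exists_freiman_eq_sum
    (fun i => by have := hN i; exact_mod_cast (by linarith : (2 : ℝ) ≤ P.side i)) hη
  choose s hs0 hs using fun i => exists_sign_of_mem_Icc (ha i).1 (ha i).2
  choose α hα using fun i => QuotientAddGroup.mk_surjective (s i • θ i)
  have hα' (i) : ((α i : ℝ) : UnitAddCircle) = s i • θ i := hα i
  set M : Fin d → ℕ := fun i => ⌊ε * P.side i / 10⌋₊ with hMdef
  have hM_le (i) : (M i : ℝ) ≤ ε * P.side i / 10 := Nat.floor_le (by positivity)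
  have hM_lt (i) : ε * P.side i / 10 < (M i : ℝ) + 1 := Nat.lt_floor_add_one _
  have hM (i) : 0 < M i := Nat.floor_pos.2 (by linarith [hεN i])
  obtain ⟨w, L, hw, hinj, hL⟩ := exists_progression_in_bohr α M hM (half_pos hε) (by linarith)
  -- Dirichlet's theorem for the value of the form at the corner `M`.
  obtain ⟨j, hj, hjξ⟩ := AddCircle.exists_norm_nsmul_le (T := (1 : ℝ))
    (∑ i, ((M i * α i : ℝ) : UnitAddCircle)) (n := ⌈2 / ε⌉₊) (Nat.ceil_pos.2 (by positivity))
  rw [Set.mem_Icc] at hj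
  have hj_le : (j : ℝ) ≤ 2 / ε + 1 :=
    (Nat.cast_le.2 hj.2).trans (Nat.ceil_lt_add_one (by positivity)).le
  have hjξ' : ‖j • ∑ i, ((M i * α i : ℝ) : UnitAddCircle)‖ ≤ ε / 2 := by
    refine hjξ.trans ?_
    have h1 : 2 / ε ≤ ⌈2 / ε⌉₊ := Nat.le_ceil _
    rw [div_le_iff₀ (by positivity)]
    rw [div_le_iff₀ hε] at h1
    push_cast
    nlinarith
  set pt : (Fin (d + 1) → ℤ) → Fin d → ℤ :=
    fun t i => a i + s i * (j * M i + (∑ k, t k • w k) i) with hpt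
  have hptbox {t : Fin (d + 1) → ℤ} (ht : ∀ k, 0 ≤ t k ∧ t k ≤ L k) : pt t ∈ P.box := by
    intro i
    have hwi := abs_le.1 ((hw t ht).1 i)
    have h1 : (M i : ℤ) ≤ j * M i := by
      have : M i ≤ j * M i := Nat.le_mul_of_pos_left _ hj.1
      exact_mod_cast this
    refine hs i _ (by linarith) ?_
    -- Displacements are at most `(j + 1) * M i ≤ N i / 5 + ε * N i / 5`, under half the side.
    have h2 : 2 * (((j : ℝ) + 1) * M i) ≤ P.side i - 2 := by
      have h3 : ((j : ℝ) + 1) * M i ≤ (2 / ε + 2) * (ε * P.side i / 10) :=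
        mul_le_mul (by linarith) (hM_le i) (Nat.cast_nonneg _) (by positivity)
      have h4 : (2 / ε + 2) * (ε * P.side i / 10) = P.side i / 5 + ε * P.side i / 5 := by
        field_simp
        ring
      have := hN i
      nlinarith
    have h5 : 2 * (((j : ℤ) + 1) * M i) ≤ P.side i - 2 := by exact_mod_cast h2
    linarith
  have hηpt {t : Fin (d + 1) → ℤ} (ht : ∀ k, 0 ≤ t k ∧ t k ≤ L k) : ‖η (P.param (pt t))‖ ≤ ε := by
    have h1 : η (P.param (pt t)) = j • ∑ i, ((M i * α i : ℝ) : UnitAddCircle) +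
        ((∑ i, ((∑ k, t k • w k) i : ℝ) * α i : ℝ) : UnitAddCircle) := by
      have h2 := hθ _ (hptbox ht)
      have h3 := hθ a ha
      rw [hηa] at h3
      have h4 : η (P.param (pt t)) = ∑ i, (pt t i - a i) • θ i := by
        rw [h2, eq_neg_of_add_eq_zero_left h3.symm, neg_add_eq_sub, ← Finset.sum_sub_distrib]
        refine Finset.sum_congr rfl fun i _ => ?_
        rw [← sub_smul]
        congr 1
        ring
      have h5 (z : ℤ) (x : ℝ) : ((z * x : ℝ) : UnitAddCircle) = z • (x : UnitAddCircle) := by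
        rw [← zsmul_eq_mul, AddCircle.coe_zsmul]
      have h6 (x : Fin d → ℝ) :
          ((∑ i, x i : ℝ) : UnitAddCircle) = ∑ i, (x i : UnitAddCircle) :=
        map_sum (QuotientAddGroup.mk' (AddSubgroup.zmultiples (1 : ℝ))) x Finset.univ
      rw [h4, Finset.smul_sum, h6, ← Finset.sum_add_distrib]
      refine Finset.sum_congr rfl fun i _ => ?_
      have h7 : ((M i * α i : ℝ) : UnitAddCircle) = (M i : ℤ) • (α i : UnitAddCircle) := by
        rw [← h5, Int.cast_natCast]
      rw [h5, h7, hα', ← natCast_zsmul, smul_smul, smul_smul, smul_smul, ← add_smul]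
      congr 1
      simp only [hpt]
      ring
    rw [h1]
    exact (norm_add_le _ _).trans (by linarith [(hw t ht).2])
  -- Boxes start at `1`, so the base is one step of each kind before the point with `t = 0`.
  let Q : Progression G (d + 1) :=
    { base := P.param (pt 0) - ∑ k, ∑ i, (s i * w k i) • P.step i
      step := fun k => ∑ i, (s i * w k i) • P.step i
      side := fun k => L k + 1 }
  have hQbox {t : Fin (d + 1) → ℤ} (ht : t ∈ Q.box) (k) : 0 ≤ (t - 1) k ∧ (t - 1) k ≤ L k := by
    have h1 : 1 ≤ t k ∧ t k ≤ ((L k + 1 : ℕ) : ℤ) := ht k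
    push_cast at h1
    simp only [Pi.sub_apply, Pi.one_apply]
    omega
  have hQparam (t : Fin (d + 1) → ℤ) : Q.param t = P.param (pt (t - 1)) := by
    have h1 : ∑ i, pt (t - 1) i • P.step i = ∑ i, pt 0 i • P.step i +
        ∑ k, (t - 1) k • ∑ i, (s i * w k i) • P.step i := by
      simp only [Finset.smul_sum]
      rw [Finset.sum_comm, ← Finset.sum_add_distrib]
      refine Finset.sum_congr rfl fun i _ => ?_
      simp only [smul_smul]
      rw [← Finset.sum_smul, ← add_smul]
      congr 1
      simp only [hpt, Finset.sum_apply, Pi.smul_apply, smul_eq_mul, Pi.zero_apply, zero_mul,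
        mul_zero, Finset.sum_const_zero, add_zero, mul_add, Finset.mul_sum, add_assoc]
      congr 2
      exact Finset.sum_congr rfl fun k _ => by ring
    have h2 : Q.param t = P.base + ∑ i, pt 0 i • P.step i -
        ∑ k, ∑ i, (s i * w k i) • P.step i + ∑ k, t k • ∑ i, (s i * w k i) • P.step i := rfl
    rw [h2, Progression.param, h1]
    simp only [Pi.sub_apply, Pi.one_apply, sub_smul, one_smul, Finset.sum_sub_distrib]
    abel
  have hQ : Q.IsProper := by
    intro t ht t' ht' h
    rw [hQparam, hQparam] at h
    have h1 := hP (hptbox (hQbox ht)) (hptbox (hQbox ht')) h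
    have h2 := hinj (hQbox ht) (hQbox ht') (funext fun i => by
      have h3 := congrFun h1 i
      simp only [hpt] at h3
      exact add_left_cancel (mul_left_cancel₀ (hs0 i) (add_left_cancel h3)))
    exact sub_left_injective h2
  refine ⟨Q, ?_, ?_⟩
  · rintro _ ⟨t, ht, rfl⟩
    rw [hQparam]
    exact ⟨⟨_, hptbox (hQbox ht), rfl⟩, hηpt (hQbox ht)⟩
  · rw [hQ.ncard_carrier, hP.ncard_carrier]
    have hQside : ((∏ k, Q.side k : ℕ) : ℝ) = ∏ k, ((L k : ℝ) + 1) := by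
      simp [Q]
    rw [hQside]
    have hd' : (0 : ℝ) < d := by exact_mod_cast hd
    have h1 : (ε / 10) ^ d * ((∏ i, P.side i : ℕ) : ℝ) ≤ ∏ i, ((M i : ℝ) + 1) := by
      calc (ε / 10) ^ d * ((∏ i, P.side i : ℕ) : ℝ) = ∏ i, (ε / 10 * P.side i) := by
            rw [Finset.prod_mul_distrib, Finset.prod_const, Finset.card_fin, Nat.cast_prod]
        _ ≤ _ := Finset.prod_le_prod (fun i _ => by positivity) fun i _ => by
            linarith [hM_lt i]
    have h2 : ε / 4 * ((ε / 10) ^ d * ((∏ i, P.side i : ℕ) : ℝ)) ≤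
        (4 * (d + 1)) ^ (d + 1) * ∏ k, ((L k : ℝ) + 1) :=
      (mul_le_mul_of_nonneg_left h1 (by positivity)).trans (by linarith [hL])
    have hpos : 0 < (5120 * (d : ℝ)) ^ d := by positivity
    rw [mul_assoc, inv_mul_le_iff₀ hpos]
    have hLpos : 0 ≤ ∏ k, ((L k : ℝ) + 1) := Finset.prod_nonneg fun k _ => by positivity
    calc ε ^ (d + 1) * ((∏ i, P.side i : ℕ) : ℝ)
        = 4 * 10 ^ d * (ε / 4 * ((ε / 10) ^ d * ((∏ i, P.side i : ℕ) : ℝ))) := by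
          rw [div_pow]
          field_simp
          ring
      _ ≤ 4 * 10 ^ d * ((4 * (d + 1)) ^ (d + 1) * ∏ k, ((L k : ℝ) + 1)) := by gcongr
      _ = 4 * 10 ^ d * (4 * (d + 1)) ^ (d + 1) * ∏ k, ((L k : ℝ) + 1) := by ring
      _ ≤ _ := mul_le_mul_of_nonneg_right (pow_mul_pow_le_mul_pow hd) hLpos

theorem lemmaB1 :
    ∃ C : ℝ, 0 < C ∧
      ∀ (G : Type*) [AddCommGroup G] (d : ℕ) (P : Progression G d) (ε : ℝ)
        (η : G → UnitAddCircle),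
        0 < ε → ε < 1 / 2 →
        P.IsProper →
        (∀ i, C / ε < (P.side i : ℝ)) →
        IsAddFreimanHom 2 P.carrier Set.univ η →
        (∃ x ∈ P.carrier, η x = 0) →
        ∃ k : ℕ, k ≤ d + 1 ∧ ∃ Q : Progression G k,
          Q.carrier ⊆ {x ∈ P.carrier | ‖η x‖ ≤ ε} ∧
          (C * (d : ℝ)) ^ (-(d : ℤ)) * ε ^ (d + 1) * (P.carrier.ncard : ℝ)
            ≤ (Q.carrier.ncard : ℝ) := by
  refine ⟨5120, by norm_num, fun G _ d P ε η hε hε2 hP hside hη hzero => ?_⟩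
  -- For `d = 0`, `P` is the single zero of `η` and serves as `Q`.
  rcases Nat.eq_zero_or_pos d with rfl | hd
  · obtain ⟨_, ⟨a, ha, rfl⟩, hηa⟩ := hzero
    refine ⟨0, Nat.zero_le _, P, ?_, ?_⟩
    · rintro _ ⟨b, hb, rfl⟩
      refine ⟨⟨b, hb, rfl⟩, ?_⟩
      rw [Subsingleton.elim b a, hηa, norm_zero]
      exact hε.le
    · have h1 : ε * (P.carrier.ncard : ℝ) ≤ P.carrier.ncard :=
        mul_le_of_le_one_left (Nat.cast_nonneg _) (by linarith)
      simpa using h1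
  · obtain ⟨Q, hQ, hcard⟩ := P.exists_progression_subset_bohr hd hε hε2 hP hside hη hzero
    refine ⟨d + 1, le_rfl, Q, hQ, ?_⟩
    rwa [zpow_neg, zpow_natCast]
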